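/- Let $d\ge 1$ and $n$ be natural numbers, and let $M_n$ be the space of $n\times n$ complex matrices. Let $$V^d_n=\{X=(X^1,\dots,X^d)\in M_n^d : X^rX^s=X^sX^r \text{ for all } 1\le r,s\le d\}$$ be the commuting variety, and let $$V^d_{n,\mathrm{gen}}=\{X\in V^d_n : \text{each } X^r \text{ has } n \text{ distinct eigenvalues}\}.$$ Regard $M_n^d\cong\mathbb C^{dn^2}$ with the Zariski topology, and for $S\subseteq M_n^d$ let $\dim_{\mathbb C}S$ be the Krull dimension of $S$ in the subspace topology, that is, the supremum of the lengths $\ell$ of chains $Z_0\subsetneq Z_1\subsetneq\dots\subsetneq Z_\ell$ of non-empty irreducible relatively closed subsets of $S$ (with $\dim_{\mathbb C}\emptyset=-\infty$). If $V^d_n$ is irreducible, then $$\dim_{\mathbb C}\bigl(V^d_n\setminus V^d_{n,\mathrm{gen}}\bigr)<\dim_{\mathbb C}V^d_{n,\mathrm{gen}}=n^2+(d-1)n .$$ -/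

import Mathlib

/-- The Zariski topology on the complex affine space `ℂ^σ`: the closed sets are the common zero
sets of arbitrary families of polynomials. -/
@[reducible]
def zariskiTopology (σ : Type*) : TopologicalSpace (σ → ℂ) :=
  TopologicalSpace.ofClosed
    {Z | ∃ P : Set (MvPolynomial σ ℂ), Z = {x | ∀ p ∈ P, MvPolynomial.eval x p = 0}}
    ⟨{1}, by ext x; simp⟩
    (by
      intro A hA
      refine ⟨{p | ∃ Z ∈ A, ∀ x ∈ Z, MvPolynomial.eval x p = 0}, ?_⟩
      ext x
      simp only [Set.mem_sInter, Set.mem_ofPred_eq]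
      constructor
      · rintro h p ⟨Z, hZ, hp⟩
        exact hp x (h Z hZ)
      · intro h Z hZ
        obtain ⟨P, rfl⟩ := hA hZ
        intro p hp
        exact h p ⟨_, hZ, fun y hy => hy p hp⟩)
    (by
      rintro _ ⟨P, rfl⟩ _ ⟨Q, rfl⟩
      refine ⟨{f | ∃ p ∈ P, ∃ q ∈ Q, f = p * q}, ?_⟩
      ext x
      simp only [Set.mem_union, Set.mem_ofPred_eq]
      constructor
      · rintro (h | h) f ⟨p, hp, q, hq, rfl⟩
        · simp [h p hp]
        · simp [h q hq]
      · intro h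
        by_contra! hc
        obtain ⟨⟨p, hp, hp0⟩, ⟨q, hq, hq0⟩⟩ := hc
        have := h _ ⟨p, hp, q, hq, rfl⟩
        rw [map_mul] at this
        exact (mul_ne_zero hp0 hq0) this)

/-- `d`-tuples of `n × n` complex matrices. -/
abbrev MatrixTuple (d n : ℕ) : Type := Fin d → Matrix (Fin n) (Fin n) ℂ

/-- The `d n²` entries of a `d`-tuple of matrices, as a point of affine space. -/
def MatrixTuple.entries {d n : ℕ} (X : MatrixTuple d n) : Fin d × Fin n × Fin n → ℂ :=
  fun k => X k.1 k.2.1 k.2.2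

/-- The Zariski topology on `d`-tuples of matrices: closed sets are the sets cut out by
polynomials in the `d n²` matrix entries. (It is not an instance, since the type of tuples of
matrices already carries the Euclidean topology.) -/
@[reducible]
def MatrixTuple.zariski (d n : ℕ) : TopologicalSpace (MatrixTuple d n) :=
  (zariskiTopology (Fin d × Fin n × Fin n)).induced MatrixTuple.entries

/-- A set of tuples is irreducible: it is nonempty and not covered by two Zariski closed sets
unless one of them contains it. -/
def ZariskiIrreducible {d n : ℕ} (S : Set (MatrixTuple d n)) : Prop :=
  @IsIrreducible _ (MatrixTuple.zariski d n) S

/-- The complex (algebraic) dimension of a set of tuples: the Krull dimension of the set with the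
subspace topology of the Zariski topology, that is, the supremum of the lengths of strict chains
of nonempty irreducible relatively closed subsets. The empty set has dimension `⊥`. -/
noncomputable def complexDim {d n : ℕ} (S : Set (MatrixTuple d n)) : WithBot ℕ∞ :=
  @topologicalKrullDim S ((MatrixTuple.zariski d n).induced Subtype.val)

/-- The commuting variety: `d`-tuples of pairwise commuting `n × n` complex matrices. -/
def commutingVariety (d n : ℕ) : Set (MatrixTuple d n) :=
  {X | ∀ r s : Fin d, X r * X s = X s * X r}

/-- The generic commuting tuples: each component has `n` distinct eigenvalues. -/
def genericCommuting (d n : ℕ) : Set (MatrixTuple d n) :=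
  {X | X ∈ commutingVariety d n ∧ ∀ r : Fin d, (spectrum ℂ (X r)).ncard = n}

open Matrix Topology

/-! Put `d = e + 1` and `N = e * n + n * n`. A matrix with distinct eigenvalues commutes only with
polynomials in itself (`Matrix.exists_sum_pow_of_commute`), so tuples `(A, A + p₁(A), …, A + pₑ(A))`
with `deg pₛ < n` fill the generic locus and map affine `N`-space into the variety. Upper bounds: by
irreducibility, polynomials killed by the comorphism `paramHom` vanish on the whole variety
(`eval_eq_zero_of_mem_commutingVariety`). The quotient by its kernel embeds in a polynomial ring in
`N` variables, so it is a domain of dimension at most `N`. Non-generic tuples are also zeros of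
`tupleDiscr`, nonzero in this domain, which costs one dimension. Lower bound: a coordinate flag in
the parameter space yields a chain of length `N` (`le_topologicalKrullDim_of_flag`). -/

open MvPolynomial in
/-- The ideal of polynomials vanishing on the image of a set under a map to affine space. -/
def vanishingIdealAlong {Y τ : Type*} (g : Y → τ → ℂ) (Z : Set Y) : Ideal (MvPolynomial τ ℂ) where
  carrier := {p | ∀ y ∈ Z, eval (g y) p = 0}
  add_mem' hp hq y hy := by simp [hp y hy, hq y hy]
  zero_mem' y _ := by simp
  smul_mem' c p hp y hy := by simp [hp y hy]

/-! ### Closed sets, vanishing ideals and Krull dimension -/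

theorem isClosed_zariskiTopology_iff {σ : Type*} {Z : Set (σ → ℂ)} :
    IsClosed[zariskiTopology σ] Z ↔
      ∃ P : Set (MvPolynomial σ ℂ), Z = {x | ∀ p ∈ P, MvPolynomial.eval x p = 0} := by
  rw [← @isOpen_compl_iff _ _ (zariskiTopology σ)]
  change Zᶜᶜ ∈ {Z | ∃ P : Set (MvPolynomial σ ℂ), Z = {x | ∀ p ∈ P, MvPolynomial.eval x p = 0}} ↔ _
  rw [compl_compl]
  rfl

theorem isClosed_induced_zariskiTopology_iff {Y τ : Type*} {g : Y → τ → ℂ} {Z : Set Y} :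
    IsClosed[(zariskiTopology τ).induced g] Z ↔
      ∃ P : Set (MvPolynomial τ ℂ), Z = {y | ∀ p ∈ P, MvPolynomial.eval (g y) p = 0} := by
  rw [@isClosed_induced_iff _ _ (zariskiTopology τ)]
  constructor
  · rintro ⟨t, ht, rfl⟩
    obtain ⟨P, rfl⟩ := isClosed_zariskiTopology_iff.1 ht
    exact ⟨P, rfl⟩
  · rintro ⟨P, rfl⟩
    exact ⟨_, isClosed_zariskiTopology_iff.2 ⟨P, rfl⟩, rfl⟩

theorem isClosed_zeroLocus_along {Y τ : Type*} (g : Y → τ → ℂ) (p : MvPolynomial τ ℂ) :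
    IsClosed[(zariskiTopology τ).induced g] {y | MvPolynomial.eval (g y) p = 0} :=
  isClosed_induced_zariskiTopology_iff.2 ⟨{p}, by simp⟩

theorem isPrime_vanishingIdealAlong {Y τ : Type*} {g : Y → τ → ℂ} {Z : Set Y}
    (hZ : @IsIrreducible _ ((zariskiTopology τ).induced g) Z) :
    (vanishingIdealAlong g Z).IsPrime := by
  let := (zariskiTopology τ).induced g
  refine ⟨?_, ?_⟩
  · rw [Ideal.ne_top_iff_one]
    intro h
    obtain ⟨y, hy⟩ := hZ.1
    simpa using h y hy
  · intro p q hpq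
    have := isPreirreducible_iff_isClosed_union_isClosed.1 hZ.2 _ _
      (isClosed_zeroLocus_along g p) (isClosed_zeroLocus_along g q) (fun y hy => by
        have := hpq y hy
        rw [map_mul] at this
        exact mul_eq_zero.1 this)
    exact this

/-- Taking vanishing ideals reverses inclusions strictly, since a closed set is recovered from its
ideal; irreducible sets give primes containing `J`. -/
theorem topologicalKrullDim_le_ringKrullDim_quotient {Y τ : Type*} (g : Y → τ → ℂ)
    (J : Ideal (MvPolynomial τ ℂ)) (hJ : ∀ p ∈ J, ∀ y, MvPolynomial.eval (g y) p = 0) :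
    @topologicalKrullDim Y ((zariskiTopology τ).induced g) ≤
      ringKrullDim (MvPolynomial τ ℂ ⧸ J) := by
  let := (zariskiTopology τ).induced g
  rw [ringKrullDim_quotient]
  let F : TopologicalSpace.IrreducibleCloseds Y →
      (PrimeSpectrum.zeroLocus (R := MvPolynomial τ ℂ) J)ᵒᵈ := fun Z =>
    OrderDual.toDual ⟨⟨vanishingIdealAlong g (Z : Set Y), isPrime_vanishingIdealAlong Z.isIrreducible⟩,
      fun p hp y _ => hJ p hp y⟩
  have hF : StrictMono F := by
    intro Z W hZW
    have hle : vanishingIdealAlong g (W : Set Y) ≤ vanishingIdealAlong g (Z : Set Y) :=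
      fun p hp y hy => hp y (hZW.le hy)
    refine lt_of_le_not_ge hle fun (h : vanishingIdealAlong g (Z : Set Y) ≤
      vanishingIdealAlong g (W : Set Y)) => ?_
    refine hZW.not_ge fun y hy => ?_
    obtain ⟨P, hP⟩ := isClosed_induced_zariskiTopology_iff.1 Z.isClosed
    have : ∀ p ∈ P, p ∈ vanishingIdealAlong g (Z : Set Y) := by
      intro p hp z hz
      have hz' : z ∈ (Z : Set Y) := hz
      rw [hP] at hz'
      exact hz' p hp
    change y ∈ (Z : Set Y)
    rw [hP]
    exact fun p hp => h (this p hp) y hy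
  refine (Order.krullDim_le_of_strictMono F hF).trans_eq ?_
  exact Order.krullDim_orderDual

/-- Incomparability: a strict chain of primes contracts to a strict chain. -/
theorem ringKrullDim_le_of_isIntegral {A B : Type*} [CommRing A] [CommRing B] (f : A →+* B)
    (hf : f.IsIntegral) : ringKrullDim B ≤ ringKrullDim A := by
  algebraize [f]
  refine Order.krullDim_le_of_strictMono (PrimeSpectrum.comap f) fun p q hpq => ?_
  exact Ideal.IsIntegral.comap_lt_comap hpq

/-- Noether normalization makes `B` integral over a polynomial ring, whose number of variables is
bounded by transcendence degree. -/
theorem ringKrullDim_le_of_injective_mvPolynomial {k B σ : Type} [Field k] [CommRing B] [Algebra k B]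
    [Algebra.FiniteType k B] [Fintype σ] (f : B →ₐ[k] MvPolynomial σ k)
    (hf : Function.Injective f) : ringKrullDim B ≤ Fintype.card σ := by
  have : Nontrivial B := f.toRingHom.domain_nontrivial
  obtain ⟨s, g, hg, hint⟩ := exists_integral_inj_algHom_of_fg k B
  refine (ringKrullDim_le_of_isIntegral g.toRingHom hint).trans ?_
  rw [MvPolynomial.ringKrullDim_of_isNoetherianRing, ringKrullDim_eq_zero_of_field]
  have h := trdeg_le_of_injective (f.comp g) (hf.comp hg)
  rw [MvPolynomial.trdeg_of_isDomain, MvPolynomial.trdeg_of_isDomain] at h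
  simp at h
  simpa using h

/-! ### Upper bounds from a parametrization -/

section Parametrized

open MvPolynomial

variable {σ τ : Type} [Fintype σ] [Finite τ] (f : MvPolynomial τ ℂ →ₐ[ℂ] MvPolynomial σ ℂ)

theorem ringKrullDim_quotient_ker_le :
    ringKrullDim (MvPolynomial τ ℂ ⧸ RingHom.ker f) ≤ Fintype.card σ :=
  ringKrullDim_le_of_injective_mvPolynomial (Ideal.kerLiftAlg f) (Ideal.kerLiftAlg_injective f)

theorem topologicalKrullDim_add_one_le_card {Y : Type*} (g : Y → τ → ℂ)
    (hg : ∀ p, f p = 0 → ∀ y, eval (g y) p = 0) (D : MvPolynomial τ ℂ) (hD : f D ≠ 0)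
    (hDg : ∀ y, eval (g y) D = 0) :
    @topologicalKrullDim Y ((zariskiTopology τ).induced g) + 1 ≤ Fintype.card σ := by
  have hprime : (RingHom.ker f).IsPrime := RingHom.ker_isPrime f
  let D' : MvPolynomial τ ℂ ⧸ RingHom.ker f := Ideal.Quotient.mk _ D
  have hD' : D' ≠ 0 := by
    simpa [D', Ideal.Quotient.eq_zero_iff_mem] using hD
  refine le_trans ?_ ((ringKrullDim_quotient_succ_le_of_nonZeroDivisor
    (mem_nonZeroDivisors_of_ne_zero hD')).trans (ringKrullDim_quotient_ker_le f))
  gcongr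
  let π : MvPolynomial τ ℂ →+* (MvPolynomial τ ℂ ⧸ RingHom.ker f) ⧸ Ideal.span {D'} :=
    (Ideal.Quotient.mk _).comp (Ideal.Quotient.mk _)
  have hπ : Function.Surjective π :=
    Ideal.Quotient.mk_surjective.comp Ideal.Quotient.mk_surjective
  refine (topologicalKrullDim_le_ringKrullDim_quotient g (RingHom.ker π) ?_).trans_eq
    (ringKrullDim_eq_of_ringEquiv (RingHom.quotientKerEquivOfSurjective hπ))
  intro p hp y
  obtain ⟨q, hq⟩ := Ideal.mem_span_singleton.1 (Ideal.Quotient.eq_zero_iff_mem.1 hp)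
  obtain ⟨q, rfl⟩ := Ideal.Quotient.mk_surjective q
  rw [← map_mul, Ideal.Quotient.eq] at hq
  -- `p - D * q` lies in the kernel of `f`, so it vanishes on `Y`, as does `D`.
  have := hg _ hq y
  simpa [hDg y] using this

end Parametrized

/-! ### Lower bound from a coordinate flag -/

section CoordinateFlag

open MvPolynomial

theorem MvPolynomial.exists_eval_ne_zero {σ : Type*} {p : MvPolynomial σ ℂ} (hp : p ≠ 0) :
    ∃ x, eval x p ≠ 0 := by
  by_contra! h
  exact hp (MvPolynomial.funext fun x => by simpa using h x)

variable {N : ℕ}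

/-- The point `x` with the coordinates from the `k`-th on replaced by those of `u`. -/
def flagPoint (u : Fin N → ℂ) (k : ℕ) (x : Fin N → ℂ) : Fin N → ℂ :=
  fun j => if (j : ℕ) < k then x j else u j

/-- Restriction of polynomials to the coordinate flag through `u`. -/
noncomputable def flagRestrict (u : Fin N → ℂ) (k : ℕ) :
    MvPolynomial (Fin N) ℂ →ₐ[ℂ] MvPolynomial (Fin N) ℂ :=
  aeval fun j => if (j : ℕ) < k then X j else C (u j)

theorem eval_flagRestrict (u : Fin N → ℂ) (k : ℕ) (x : Fin N → ℂ) (p : MvPolynomial (Fin N) ℂ) :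
    eval x (flagRestrict u k p) = eval (flagPoint u k x) p := by
  induction p using MvPolynomial.induction_on with
  | C a => simp [flagRestrict]
  | add p q hp hq => simp [hp, hq]
  | mul_X p j hp =>
    rw [map_mul, map_mul, hp, map_mul]
    congr 1
    by_cases h : (j : ℕ) < k <;> simp [flagRestrict, flagPoint, h]

theorem flagPoint_of_le {u : Fin N → ℂ} {k : ℕ} {x : Fin N → ℂ} {j : Fin N} (h : k ≤ j) :
    flagPoint u k x j = u j := by
  simp [flagPoint, h]

theorem flagPoint_eq_self {u : Fin N → ℂ} {k : ℕ} {x : Fin N → ℂ}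
    (h : ∀ j : Fin N, k ≤ j → x j = u j) : flagPoint u k x = x := by
  ext j
  by_cases hj : (j : ℕ) < k
  · simp [flagPoint, hj]
  · rw [flagPoint_of_le (not_lt.1 hj), h j (not_lt.1 hj)]

theorem flagRestrict_ne_zero {u x : Fin N → ℂ} {k : ℕ} {p : MvPolynomial (Fin N) ℂ}
    (h : ∀ j : Fin N, k ≤ j → x j = u j) (hp : eval x p ≠ 0) : flagRestrict u k p ≠ 0 := by
  intro h0
  have := eval_flagRestrict u k x p
  rw [h0, flagPoint_eq_self h, map_zero] at this
  exact hp this.symm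

/-- If a principal open subset of affine `N`-space is parametrized into `Y` in such a way that the
coordinates along a full flag through `u` can be read off by polynomials on `Y`, then `Y` has
dimension at least `N`. -/
theorem le_topologicalKrullDim_of_flag {τ Y : Type*} (g : Y → τ → ℂ)
    (f : MvPolynomial τ ℂ →ₐ[ℂ] MvPolynomial (Fin N) ℂ) (D : MvPolynomial (Fin N) ℂ)
    (h : {x : Fin N → ℂ // eval x D ≠ 0} → Y)
    (hh : ∀ x p, eval (g (h x)) p = eval x.1 (f p))
    (u : Fin N → ℂ) (hu : eval u D ≠ 0) (P : Fin N → MvPolynomial τ ℂ)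
    (hP : ∀ (k : Fin N) (x : Fin N → ℂ), (∀ j, k < j → x j = u j) →
      eval x (f (P k)) = x k - u k) :
    (N : WithBot ℕ∞) ≤ @topologicalKrullDim Y ((zariskiTopology τ).induced g) := by
  let := (zariskiTopology τ).induced g
  let L : ℕ → Set {x : Fin N → ℂ // eval x D ≠ 0} :=
    fun k => {x | ∀ j : Fin N, k ≤ j → x.1 j = u j}
  -- Two polynomials and `D`, each nonzero on the `k`-th flag space, have a common non-zero there.
  have hirr : ∀ k, IsIrreducible (h '' L k) := by
    intro k
    refine ⟨⟨_, Set.mem_image_of_mem h (show ⟨u, hu⟩ ∈ L k from fun j _ => rfl)⟩, ?_⟩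
    rw [isPreirreducible_iff_isClosed_union_isClosed]
    intro Z₁ Z₂ hZ₁ hZ₂ hsub
    obtain ⟨P₁, rfl⟩ := isClosed_induced_zariskiTopology_iff.1 hZ₁
    obtain ⟨P₂, rfl⟩ := isClosed_induced_zariskiTopology_iff.1 hZ₂
    by_contra! hc
    obtain ⟨⟨_, ⟨x₁, hx₁, rfl⟩, hn₁⟩, ⟨_, ⟨x₂, hx₂, rfl⟩, hn₂⟩⟩ :=
      And.intro (Set.not_subset.1 hc.1) (Set.not_subset.1 hc.2)
    simp only [Set.mem_ofPred_eq, not_forall] at hn₁ hn₂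
    obtain ⟨p, hp, hpx⟩ := hn₁
    obtain ⟨q, hq, hqx⟩ := hn₂
    rw [hh] at hpx hqx
    obtain ⟨x, hx⟩ := MvPolynomial.exists_eval_ne_zero
      (mul_ne_zero (mul_ne_zero (flagRestrict_ne_zero hx₁ hpx) (flagRestrict_ne_zero hx₂ hqx))
        (flagRestrict_ne_zero (u := u) (k := k) (fun _ _ => rfl) hu))
    rw [map_mul, map_mul] at hx
    simp only [eval_flagRestrict, mul_ne_zero_iff] at hx
    have hmem : h ⟨flagPoint u k x, hx.2⟩ ∈ h '' L k :=
      Set.mem_image_of_mem h (show ⟨flagPoint u k x, hx.2⟩ ∈ L k from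
        fun j hj => flagPoint_of_le hj)
    rcases hsub hmem with h1 | h1
    · have h2 := (show ∀ r ∈ P₁, eval (g (h ⟨flagPoint u k x, hx.2⟩)) r = 0 from h1) p hp
      rw [hh] at h2
      exact hx.1.1 h2
    · have h2 := (show ∀ r ∈ P₂, eval (g (h ⟨flagPoint u k x, hx.2⟩)) r = 0 from h1) q hq
      rw [hh] at h2
      exact hx.1.2 h2
  let F : Fin (N + 1) → TopologicalSpace.IrreducibleCloseds Y := fun k =>
    ⟨closure (h '' L k), (hirr k).closure, isClosed_closure⟩
  have hF : StrictMono F := by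
    rw [Fin.strictMono_iff_lt_succ]
    intro k
    have hle : F k.castSucc ≤ F k.succ := by
      refine closure_mono (Set.image_mono ?_)
      intro x hx j hj
      exact hx j ((Nat.le_succ _).trans hj)
    refine lt_of_le_not_ge hle fun hge => ?_
    have hcl : closure (h '' L k) ⊆ {y | eval (g y) (P k) = 0} := by
      refine closure_minimal ?_ (isClosed_zeroLocus_along g (P k))
      rintro _ ⟨x, hx, rfl⟩
      rw [Set.mem_ofPred_eq, hh, hP k x.1 fun j hj => hx j (Fin.le_def.1 hj.le), hx k le_rfl, sub_self]
    -- The next stage has a point with `D ≠ 0` and `k`-th coordinate different from `u k`, where `P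
    -- k` does not vanish.
    have hne : flagRestrict u (k + 1) (D * (X k - C (u k))) ≠ 0 := by
      rw [map_mul]
      refine mul_ne_zero (flagRestrict_ne_zero (fun _ _ => rfl) hu)
        (flagRestrict_ne_zero (x := Function.update u k (u k + 1)) ?_ (by simp))
      intro j hj
      rw [Function.update_of_ne]
      rintro rfl
      omega
    obtain ⟨x, hx⟩ := MvPolynomial.exists_eval_ne_zero hne
    rw [eval_flagRestrict, map_mul, mul_ne_zero_iff] at hx
    have hmem : h ⟨flagPoint u (k + 1) x, hx.1⟩ ∈ closure (h '' L (k + 1)) :=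
      subset_closure (Set.mem_image_of_mem h
        (show ⟨flagPoint u (k + 1) x, hx.1⟩ ∈ L (k + 1) from fun j hj => flagPoint_of_le hj))
    have h0 := hcl (hge hmem)
    rw [Set.mem_ofPred_eq, hh, hP k _ fun j hj => flagPoint_of_le (Nat.succ_le_of_lt hj)] at h0
    apply hx.2
    simpa using h0
  exact Order.LTSeries.length_le_krullDim (LTSeries.mk N F hF)

end CoordinateFlag

/-! ### Matrices with distinct eigenvalues -/

section DistinctEigenvalues

variable {n : ℕ}

/-- By spectral mapping the determinant is nonzero iff the derivative of the characteristic
polynomial vanishes at no eigenvalue, i.e. all roots are simple. -/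
theorem Matrix.ncard_spectrum_eq_iff (A : Matrix (Fin n) (Fin n) ℂ) :
    (spectrum ℂ A).ncard = n ↔ (Polynomial.aeval A A.charpoly.derivative).det ≠ 0 := by
  have h0 : A.charpoly ≠ 0 := A.charpoly_monic.ne_zero
  have hs : spectrum ℂ A = A.charpoly.roots.toFinset := by
    ext z
    simp [Matrix.mem_spectrum_iff_isRoot_charpoly, h0]
  have hcard : A.charpoly.roots.card = n := by
    rw [← (IsAlgClosed.splits A.charpoly).natDegree_eq_card_roots, A.charpoly_natDegree_eq_dim,
      Fintype.card_fin]
  have key : (spectrum ℂ A).ncard = n ↔ A.charpoly.roots.Nodup := by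
    rw [hs, Set.ncard_coe_finset, ← Multiset.toFinset_card_eq_card_iff_nodup, hcard]
  rw [key]
  rcases Nat.eq_zero_or_pos n with rfl | hn
  · simp
  have : Nonempty (Fin n) := ⟨⟨0, hn⟩⟩
  have hne : (spectrum ℂ A).Nonempty := spectrum.nonempty_of_isAlgClosed_of_finiteDimensional ℂ A
  rw [← isUnit_iff_ne_zero, ← Matrix.isUnit_iff_isUnit_det, ← spectrum.zero_notMem_iff ℂ,
    spectrum.map_polynomial_aeval_of_nonempty A _ hne, Multiset.nodup_iff_count_le_one]
  simp only [Polynomial.count_roots, Set.mem_image, not_exists, not_and,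
    Matrix.mem_spectrum_iff_isRoot_charpoly]
  refine forall_congr' fun z => ?_
  rw [← not_lt, Polynomial.one_lt_rootMultiplicity_iff_isRoot h0, not_and]
  rfl

/-- `B` preserves the eigenlines of `A`, so it is diagonal in an eigenbasis; interpolating its
eigenvalues at those of `A` gives the polynomial. -/
theorem Matrix.exists_sum_pow_of_commute {A B : Matrix (Fin n) (Fin n) ℂ}
    (hA : (spectrum ℂ A).ncard = n) (h : A * B = B * A) :
    ∃ c : Fin n → ℂ, B = ∑ i, c i • A ^ (i : ℕ) := by
  obtain ⟨μ, hinj, hμ⟩ : ∃ μ : Fin n → ℂ, Function.Injective μ ∧ ∀ i, μ i ∈ spectrum ℂ A := by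
    have e : spectrum ℂ A ≃ Fin n :=
      Finite.equivFinOfCardEq ((Nat.card_coe_set_eq _).trans hA)
    exact ⟨fun i => e.symm i, Subtype.val_injective.comp e.symm.injective, fun i => (e.symm i).2⟩
  have hv : ∀ i, ∃ v : Fin n → ℂ, Module.End.HasEigenvector (Matrix.toLin' A) (μ i) v := by
    intro i
    have := hμ i
    rw [← Matrix.spectrum_toLin', ← Module.End.hasEigenvalue_iff_mem_spectrum] at this
    exact this.exists_hasEigenvector
  choose v hv using hv
  have hli : LinearIndependent ℂ v :=
    Module.End.eigenvectors_linearIndependent' (Matrix.toLin' A) μ hinj v hv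
  have hspan : ⊤ ≤ Submodule.span ℂ (Set.range v) := by
    rw [hli.span_eq_top_of_card_eq_finrank' (by simp)]
  let b := Module.Basis.mk hli hspan
  have hb : ∀ i, b i = v i := fun i => by simp [b]
  have hAv : ∀ i, A *ᵥ v i = μ i • v i := fun i => (hv i).apply_eq_smul
  have hrepr : ∀ w j, b.repr (A *ᵥ w) j = μ j * b.repr w j := by
    intro w j
    have : (b.coord j) ∘ₗ Matrix.toLin' A = μ j • b.coord j := by
      refine b.ext fun i => ?_
      rw [LinearMap.comp_apply, Matrix.toLin'_apply, hb, hAv, map_smul, LinearMap.smul_apply, ← hb]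
      by_cases hij : i = j <;> simp [hij]
    exact LinearMap.congr_fun this w
  have hB : ∀ i, B *ᵥ v i = b.repr (B *ᵥ v i) i • v i := by
    intro i
    have h1 : A *ᵥ (B *ᵥ v i) = μ i • (B *ᵥ v i) := by
      rw [Matrix.mulVec_mulVec, h, ← Matrix.mulVec_mulVec, hAv, Matrix.mulVec_smul]
    apply b.repr.injective
    ext j
    rw [map_smul, ← hb i, b.repr_self, Finsupp.smul_apply]
    by_cases hij : i = j
    · subst hij; simp
    · have h2 := hrepr (B *ᵥ v i) j
      rw [h1, map_smul, Finsupp.smul_apply, smul_eq_mul] at h2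
      have h3 : (μ i - μ j) * b.repr (B *ᵥ v i) j = 0 := by rw [sub_mul, h2, sub_self]
      rcases mul_eq_zero.1 h3 with h4 | h4
      · exact absurd (hinj (sub_eq_zero.1 h4)) hij
      · rw [hb, h4]; simp [hij]
  have hdet : IsUnit (Matrix.vandermonde μ).det :=
    isUnit_iff_ne_zero.2 (Matrix.det_vandermonde_ne_zero_iff.2 hinj)
  let c := (Matrix.vandermonde μ)⁻¹ *ᵥ fun i => b.repr (B *ᵥ v i) i
  have hc : ∀ i, ∑ k, c k * μ i ^ (k : ℕ) = b.repr (B *ᵥ v i) i := by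
    intro i
    have : Matrix.vandermonde μ *ᵥ c = fun i => b.repr (B *ᵥ v i) i := by
      rw [Matrix.mulVec_mulVec, Matrix.mul_nonsing_inv _ hdet, Matrix.one_mulVec]
    rw [← congrFun this i]
    simp [Matrix.mulVec, dotProduct, Matrix.vandermonde_apply, mul_comm]
  have hpow : ∀ i (k : ℕ), A ^ k *ᵥ v i = μ i ^ k • v i := by
    intro i k
    induction k with
    | zero => simp
    | succ k ih => rw [pow_succ, ← Matrix.mulVec_mulVec, hAv, Matrix.mulVec_smul, ih, smul_smul,
        pow_succ']
  refine ⟨c, (Matrix.toLin' (R := ℂ)).injective (b.ext fun i => ?_)⟩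
  rw [hb, Matrix.toLin'_apply, Matrix.toLin'_apply, hB, Matrix.sum_mulVec, ← hc, Finset.sum_smul]
  refine Finset.sum_congr rfl fun k _ => ?_
  rw [Matrix.smul_mulVec, hpow, smul_smul]

end DistinctEigenvalues

theorem RingHom.map_det_aeval_derivative_charpoly {R S : Type*} [CommRing R] [CommRing S] {n : ℕ}
    (φ : R →+* S) (A : Matrix (Fin n) (Fin n) R) :
    φ (Polynomial.aeval A A.charpoly.derivative).det =
      (Polynomial.aeval (A.map φ) (A.map φ).charpoly.derivative).det := by
  rw [RingHom.map_det, Matrix.charpoly_map, Polynomial.derivative_map]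
  congr 1
  rw [Polynomial.aeval_def, Polynomial.hom_eval₂, Polynomial.aeval_def, Polynomial.eval₂_map]
  congr 1
  ext r i j
  simp [Matrix.algebraMap_matrix_apply, apply_ite φ]

/-! ### Parametrizing generic commuting tuples -/

section Parametrization

open MvPolynomial

variable {e n : ℕ}

/-- The indices of the coefficients of the polynomials come before those of the matrix entries. -/
def paramIndex (e n : ℕ) : (Fin e × Fin n) ⊕ (Fin n × Fin n) ≃ Fin (e * n + n * n) :=
  (Equiv.sumCongr finProdFinEquiv finProdFinEquiv).trans finSumFinEquiv

theorem paramIndex_inl_lt_inr (a : Fin e × Fin n) (b : Fin n × Fin n) :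
    paramIndex e n (Sum.inl a) < paramIndex e n (Sum.inr b) := by
  rw [Fin.lt_def]
  simp only [paramIndex, Equiv.trans_apply, Equiv.sumCongr_apply, Sum.map_inl, Sum.map_inr,
    finSumFinEquiv_apply_left, finSumFinEquiv_apply_right, Fin.val_castAdd, Fin.val_natAdd]
  have := (finProdFinEquiv a).2
  omega

variable {R S : Type*} [CommRing R] [CommRing S]

/-- The matrix `A` encoded by the parameters. -/
def paramMatrix (x : Fin (e * n + n * n) → R) : Matrix (Fin n) (Fin n) R :=
  Matrix.of fun a b => x (paramIndex e n (Sum.inr (a, b)))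

/-- The commuting tuple consisting of `A` and matrices `A + ∑ cᵢ Aⁱ`. -/
def paramTuple (x : Fin (e * n + n * n) → R) : Fin (e + 1) → Matrix (Fin n) (Fin n) R :=
  Fin.cons (paramMatrix x) fun s =>
    paramMatrix x + ∑ i : Fin n, x (paramIndex e n (Sum.inl (s, i))) • paramMatrix x ^ (i : ℕ)

theorem paramTuple_map (φ : R →+* S) (x : Fin (e * n + n * n) → R) (r : Fin (e + 1)) :
    (paramTuple x r).map φ = paramTuple (φ ∘ x) r := by
  have h0 : φ.mapMatrix (paramMatrix x) = paramMatrix (φ ∘ x) := rfl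
  have hs : ∀ (a : R) (M : Matrix (Fin n) (Fin n) R),
      φ.mapMatrix (a • M) = φ a • φ.mapMatrix M := by
    intro a M
    ext i j
    simp
  change φ.mapMatrix _ = _
  refine Fin.cases h0 (fun s => ?_) r
  simp only [paramTuple, Fin.cons_succ, map_add, map_sum, hs, map_pow, h0, Function.comp_apply]

theorem paramTuple_mem_commutingVariety (x : Fin (e * n + n * n) → ℂ) :
    paramTuple x ∈ commutingVariety (e + 1) n := by
  have h : ∀ (M : Matrix (Fin n) (Fin n) ℂ) (r : Fin (e + 1)),
      Commute M (paramMatrix x) → Commute M (paramTuple x r) := by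
    intro M r hM
    refine Fin.cases hM (fun s => ?_) r
    exact hM.add_right (Commute.sum_right _ _ _ fun i _ => (hM.pow_right _).smul_right _)
  exact fun r s => h _ s (h _ r (Commute.refl _)).symm

theorem exists_paramTuple_eq {X : MatrixTuple (e + 1) n} (hX : X ∈ genericCommuting (e + 1) n) :
    ∃ x, paramTuple x = X := by
  have hc : ∀ s : Fin e, ∃ c : Fin n → ℂ, X s.succ - X 0 = ∑ i, c i • X 0 ^ (i : ℕ) := fun s =>
    Matrix.exists_sum_pow_of_commute (hX.2 0) (by rw [mul_sub, sub_mul, hX.1 0 s.succ])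
  choose c hc using hc
  let x : Fin (e * n + n * n) → ℂ := fun k =>
    Sum.elim (fun a => c a.1 a.2) (fun a => X 0 a.1 a.2) ((paramIndex e n).symm k)
  have h0 : paramMatrix x = X 0 := by
    ext a b
    simp [paramMatrix, x]
  refine ⟨x, funext fun r => Fin.cases h0 (fun s => ?_) r⟩
  simp only [paramTuple, Fin.cons_succ, h0]
  refine (sub_eq_iff_eq_add'.1 ?_).symm
  simp [hc, x]

/-- The comorphism of the parametrization. -/
noncomputable def paramHom (e n : ℕ) : MvPolynomial (Fin (e + 1) × Fin n × Fin n) ℂ →ₐ[ℂ]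
    MvPolynomial (Fin (e * n + n * n)) ℂ :=
  aeval fun k => paramTuple (X : Fin (e * n + n * n) → MvPolynomial _ ℂ) k.1 k.2.1 k.2.2

theorem eval_paramHom (x : Fin (e * n + n * n) → ℂ) (p) :
    eval x (paramHom e n p) = eval (MatrixTuple.entries (paramTuple x)) p := by
  have h : ∀ k : Fin (e + 1) × Fin n × Fin n,
      eval x (paramTuple (X : Fin (e * n + n * n) → MvPolynomial _ ℂ) k.1 k.2.1 k.2.2) =
        MatrixTuple.entries (paramTuple x) k := by
    intro k
    have := congrFun (congrFun (paramTuple_map (eval x) X k.1) k.2.1) k.2.2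
    rw [Matrix.map_apply] at this
    rw [this]
    have h2 : (eval x) ∘ (X : Fin (e * n + n * n) → MvPolynomial _ ℂ) = x := by ext; simp
    rw [h2]
    rfl
  induction p using MvPolynomial.induction_on with
  | C a => simp [paramHom]
  | add p q hp hq => simp [hp, hq]
  | mul_X p k hp =>
    rw [map_mul, map_mul, hp, map_mul, eval_X, ← h]
    simp [paramHom]

/-- The `r`-th component of the generic tuple of matrices. -/
noncomputable def genericMatrix (d n : ℕ) (r : Fin d) :
    Matrix (Fin n) (Fin n) (MvPolynomial (Fin d × Fin n × Fin n) ℂ) :=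
  Matrix.of fun a b => X (r, a, b)

/-- A polynomial in the entries of a tuple that is nonzero exactly when every component has
distinct eigenvalues. -/
noncomputable def tupleDiscr (d n : ℕ) : MvPolynomial (Fin d × Fin n × Fin n) ℂ :=
  ∏ r, (Polynomial.aeval (genericMatrix d n r) (genericMatrix d n r).charpoly.derivative).det

theorem eval_tupleDiscr_ne_zero_iff {d n : ℕ} (T : MatrixTuple d n) :
    eval T.entries (tupleDiscr d n) ≠ 0 ↔ ∀ r, (spectrum ℂ (T r)).ncard = n := by
  rw [tupleDiscr, map_prod, Finset.prod_ne_zero_iff]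
  simp only [Finset.mem_univ, true_imp_iff]
  refine forall_congr' fun r => ?_
  rw [Matrix.ncard_spectrum_eq_iff, RingHom.map_det_aeval_derivative_charpoly]
  have : (genericMatrix d n r).map (eval T.entries) = T r := by
    ext a b
    simp [genericMatrix, MatrixTuple.entries]
  rw [this]

/-- The parameters of the constant tuple at the diagonal matrix with entries `0, …, n - 1`. -/
def baseParam (e n : ℕ) : Fin (e * n + n * n) → ℂ := fun k =>
  Sum.elim (fun _ => 0) (fun a => Matrix.diagonal (fun j : Fin n => (j : ℂ)) a.1 a.2)
    ((paramIndex e n).symm k)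

theorem paramMatrix_baseParam :
    paramMatrix (baseParam e n) = Matrix.diagonal (fun j : Fin n => (j : ℂ)) := by
  ext a b
  simp [paramMatrix, baseParam]

/-- The summand `A` in every component of `paramTuple` makes zero coefficients give a generic tuple.
-/
theorem paramTuple_baseParam (r : Fin (e + 1)) :
    paramTuple (baseParam e n) r = Matrix.diagonal (fun j : Fin n => (j : ℂ)) := by
  refine Fin.cases paramMatrix_baseParam (fun s => ?_) r
  simp [paramTuple, paramMatrix_baseParam, baseParam]

theorem injective_natCast_fin : Function.Injective fun j : Fin n => (j : ℂ) :=
  Nat.cast_injective.comp Fin.val_injective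

theorem eval_baseParam_ne_zero : eval (baseParam e n) (paramHom e n (tupleDiscr (e + 1) n)) ≠ 0 := by
  rw [eval_paramHom, eval_tupleDiscr_ne_zero_iff]
  intro r
  rw [paramTuple_baseParam, spectrum_diagonal, ← Set.image_univ,
    Set.ncard_image_of_injective _ injective_natCast_fin, Set.ncard_univ, Nat.card_fin]

/-- Polynomials reading off the parameters along the flag through `baseParam`. -/
noncomputable def flagCoordinate (e n : ℕ) (k : Fin (e * n + n * n)) :
    MvPolynomial (Fin (e + 1) × Fin n × Fin n) ℂ :=
  Sum.elim
    (fun a => ∑ j, C ((Matrix.vandermonde fun j : Fin n => (j : ℂ))⁻¹ a.2 j) *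
      (X (a.1.succ, j, j) - C (j : ℂ)))
    (fun a => X (0, a.1, a.2) - C (Matrix.diagonal (fun j : Fin n => (j : ℂ)) a.1 a.2))
    ((paramIndex e n).symm k)

/-- Matrix entries are read off the first component. At a coefficient index all of them, being
later, are frozen at the base point, so `A` is diagonal and the inverse Vandermonde matrix recovers
a polynomial from its values. -/
theorem eval_flagCoordinate (k : Fin (e * n + n * n)) (x : Fin (e * n + n * n) → ℂ)
    (hx : ∀ j, k < j → x j = baseParam e n j) :
    eval x (paramHom e n (flagCoordinate e n k)) = x k - baseParam e n k := by
  rw [eval_paramHom]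
  obtain ⟨k, rfl⟩ := (paramIndex e n).surjective k
  rcases k with a | a
  · have hA : paramMatrix x = Matrix.diagonal (fun j : Fin n => (j : ℂ)) := by
      rw [← paramMatrix_baseParam (e := e)]
      ext i j
      exact hx _ (paramIndex_inl_lt_inr _ _)
    let c : Fin n → ℂ := fun i => x (paramIndex e n (Sum.inl (a.1, i)))
    let V := Matrix.vandermonde fun j : Fin n => (j : ℂ)
    have hdet : IsUnit V.det :=
      isUnit_iff_ne_zero.2 (Matrix.det_vandermonde_ne_zero_iff.2 injective_natCast_fin)
    have hentry : ∀ j, paramTuple x a.1.succ j j - (j : ℂ) = (V *ᵥ c) j := by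
      intro j
      simp [paramTuple, hA, Matrix.diagonal_pow, Matrix.sum_apply, V, c, Matrix.mulVec, dotProduct,
        Matrix.vandermonde_apply, mul_comm]
    have hVc : (V⁻¹ *ᵥ (V *ᵥ c)) a.2 = c a.2 := by
      rw [Matrix.mulVec_mulVec, Matrix.nonsing_inv_mul _ hdet, Matrix.one_mulVec]
    simp only [flagCoordinate, Equiv.symm_apply_apply, Sum.elim_inl, map_sum, map_mul, map_sub,
      eval_C, eval_X, MatrixTuple.entries, hentry, baseParam, sub_zero]
    exact hVc
  · simp [flagCoordinate, baseParam, MatrixTuple.entries, paramTuple, paramMatrix]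

end Parametrization

/-! ### Dimension of the generic locus and its complement -/

section Dimension

open MvPolynomial

variable {e n : ℕ}

theorem complexDim_eq {d n : ℕ} (S : Set (MatrixTuple d n)) : complexDim S =
    @topologicalKrullDim S ((zariskiTopology _).induced (MatrixTuple.entries ∘ Subtype.val)) := by
  rw [complexDim, MatrixTuple.zariski, induced_compose]

theorem card_le_complexDim_genericCommuting :
    ((e * n + n * n : ℕ) : WithBot ℕ∞) ≤ complexDim (genericCommuting (e + 1) n) := by
  rw [complexDim_eq]
  refine le_topologicalKrullDim_of_flag _ (paramHom e n) (paramHom e n (tupleDiscr (e + 1) n))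
    (fun x => ⟨paramTuple x.1, paramTuple_mem_commutingVariety _, ?_⟩) ?_ (baseParam e n)
    eval_baseParam_ne_zero (flagCoordinate e n) eval_flagCoordinate
  · rw [← eval_tupleDiscr_ne_zero_iff, ← eval_paramHom]
    exact x.2
  · intro x p
    exact (eval_paramHom _ _).symm

/-- The variety is covered by the zeros of `p` and of `tupleDiscr`; the base point is not a zero of
the latter. -/
theorem eval_eq_zero_of_mem_commutingVariety
    (hV : ZariskiIrreducible (commutingVariety (e + 1) n)) {p} (hp : paramHom e n p = 0)
    {T : MatrixTuple (e + 1) n} (hT : T ∈ commutingVariety (e + 1) n) : eval T.entries p = 0 := by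
  let := MatrixTuple.zariski (e + 1) n
  have h := isPreirreducible_iff_isClosed_union_isClosed.1 hV.2 _ _
    (isClosed_zeroLocus_along MatrixTuple.entries p)
    (isClosed_zeroLocus_along MatrixTuple.entries (tupleDiscr (e + 1) n)) (fun Y hY => by
      by_cases hY0 : eval Y.entries (tupleDiscr (e + 1) n) = 0
      · exact Or.inr hY0
      · obtain ⟨x, rfl⟩ := exists_paramTuple_eq ⟨hY, (eval_tupleDiscr_ne_zero_iff Y).1 hY0⟩
        left
        change eval _ p = 0
        rw [← eval_paramHom, hp, map_zero])
  rcases h with h | h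
  · exact h hT
  · have h1 : eval (MatrixTuple.entries (paramTuple (baseParam e n))) (tupleDiscr (e + 1) n) = 0 :=
      h (paramTuple_mem_commutingVariety (baseParam e n))
    rw [← eval_paramHom] at h1
    exact absurd h1 eval_baseParam_ne_zero

theorem complexDim_commutingVariety_diff_add_one_le
    (hV : ZariskiIrreducible (commutingVariety (e + 1) n)) :
    complexDim (commutingVariety (e + 1) n \ genericCommuting (e + 1) n) + 1 ≤
      ((e * n + n * n : ℕ) : WithBot ℕ∞) := by
  rw [complexDim_eq]
  refine (topologicalKrullDim_add_one_le_card (paramHom e n) _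
    (fun p hp T => eval_eq_zero_of_mem_commutingVariety hV hp T.2.1) (tupleDiscr (e + 1) n)
    (fun h => eval_baseParam_ne_zero (by rw [h, map_zero])) ?_).trans_eq (by simp)
  rintro ⟨T, hT, hT'⟩
  by_contra h
  exact hT' ⟨hT, (eval_tupleDiscr_ne_zero_iff T).1 h⟩

theorem complexDim_genericCommuting_le
    (hV : ZariskiIrreducible (commutingVariety (e + 1) n)) :
    complexDim (genericCommuting (e + 1) n) ≤ ((e * n + n * n : ℕ) : WithBot ℕ∞) := by
  rw [complexDim_eq]
  refine (topologicalKrullDim_le_ringKrullDim_quotient _ (RingHom.ker (paramHom e n))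
    fun p hp T => eval_eq_zero_of_mem_commutingVariety hV hp T.2.1).trans
    ((ringKrullDim_quotient_ker_le _).trans_eq (by simp))

end Dimension

theorem proposition4p1 (d n : ℕ) (hd : 1 ≤ d)
    (hV : ZariskiIrreducible (commutingVariety d n)) :
    complexDim (commutingVariety d n \ genericCommuting d n) <
        complexDim (genericCommuting d n) ∧
      complexDim (genericCommuting d n) = ((n ^ 2 + (d - 1) * n : ℕ) : WithBot ℕ∞) := by
  obtain ⟨e, rfl⟩ := Nat.exists_eq_add_of_le' hd
  have hN : n ^ 2 + (e + 1 - 1) * n = e * n + n * n := by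
    rw [Nat.add_sub_cancel, sq, add_comm]
  have hdim := (complexDim_genericCommuting_le hV).antisymm card_le_complexDim_genericCommuting
  rw [hN, hdim]
  refine ⟨?_, rfl⟩
  have h := complexDim_commutingVariety_diff_add_one_le hV
  exact ENat.WithBot.add_one_le_natCast_iff.mp h
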